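/- Let $G=\prod_{k=0}^{\infty}\{0,1\}$ be the Walsh group with its normalized Haar measure $\mu$, let $\mathcal F_n$ be the $\sigma$-algebra generated by the dyadic intervals $I_n(x)=\{y\in G: y_i=x_i \text{ for all } i<n\}$, and let $w_n(x)=\prod_{k\ge 0}(-1)^{n_kx_k}$ ($n=\sum_k n_k2^k$, $n_k\in\{0,1\}$) be the Walsh--Paley system. For $0<p<\infty$, the Hardy space $H_p$ consists of the complex martingales $f=(f^{(n)})_{n\in\mathbb N}$ with respect to $(\mathcal F_n)$ such that $\|f\|_{H_p}:=\|\sup_n|f^{(n)}|\,\|_{p}<\infty$; an integrable function $g$ is identified with the martingale $\bigl(\mu(I_n(x))^{-1}\int_{I_n(x)}g\,d\mu\bigr)_{n}$. For such an $f$ put $\widehat f(i)=\lim_{k\to\infty}\int_G f^{(k)}\overline{w_i}\,d\mu$, $S_kf=\sum_{i=0}^{k-1}\widehat f(i)w_i$ and $\sigma_nf=\frac1n\sum_{k=1}^{n}S_kf$. Let $\|g\|_{L_{p,\infty}}=\sup_{t>0}t\,\mu(|g|>t)^{1/p}$. Let $0<p<1/2$. a) There is a constant $c_p>0$, depending only on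 $p$, such that for every $f\in H_p$ and every $n\in\mathbb N=\{0,1,2,\dots\}$ $$\|\sigma_{2^n+1}f\|_{H_p}\le c_p\,2^{(1/p-2)n}\,\|f\|_{H_p}\qquad\text{and}\qquad \|\sigma_{2^n+2^{\lfloor n/2\rfloor}}f\|_{H_p}\le c_p\,2^{(1/p-2)n/2}\,\|f\|_{H_p}.$$ b) Both rates are sharp, in the following sense. Let either $N_k=2^k+1$ and $R_k=2^{(1/p-2)k}$ for all $k\in\mathbb N$, or $N_k=2^k+2^{\lfloor k/2\rfloor}$ and $R_k=2^{(1/p-2)k/2}$ for all $k\in\mathbb N$. Then for every nondecreasing function $\Phi:\mathbb N\to(0,\infty)$ with $$\limsup_{k\to\infty}\frac{R_k}{\Phi(N_k)}=\infty$$ there is a martingale $f\in H_p$ such that $$\sup_{k\in\mathbb N}\left\|\frac{\sigma_{N_k}f}{\Phi(N_k)}\right\|_{L_{p,\infty}}=\infty .$$ -/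

import Mathlib

open MeasureTheory Filter
open scoped ENNReal NNReal

noncomputable section

namespace WalshFejer

/-- The Walsh group: the countable direct product of copies of the integers modulo 2. -/
abbrev G : Type := ℕ → Fin 2

/-- The normalized Haar measure: the product of the uniform probability measures on `{0, 1}`. -/
def haar : Measure G :=
  Measure.infinitePi fun _ : ℕ => (PMF.uniformOfFintype (Fin 2)).toMeasure

/-- The dyadic interval `I_n(x)` of the points that share the first `n` coordinates of `x`. -/
def interval (n : ℕ) (x : G) : Set G := {y | ∀ i < n, y i = x i}

/-- The σ-algebra generated by the intervals `I_n(x)`. -/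
abbrev dyadicAlgebra (n : ℕ) : MeasurableSpace G :=
  MeasurableSpace.generateFrom (Set.range (interval n))

theorem measurableSet_interval (n : ℕ) (x : G) : MeasurableSet (interval n x) := by
  have h : interval n x = ⋂ i ∈ Finset.range n, (fun y : G => y i) ⁻¹' {x i} := by
    ext y
    simp [interval]
  rw [h]
  exact Finset.measurableSet_biInter _ fun i _ =>
    (measurable_pi_apply i) (measurableSet_singleton _)

theorem dyadicAlgebra_le (n : ℕ) : dyadicAlgebra n ≤ MeasurableSpace.pi := by
  refine MeasurableSpace.generateFrom_le ?_
  rintro _ ⟨x, rfl⟩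
  exact measurableSet_interval n x

theorem interval_eq_iUnion (n : ℕ) (x : G) :
    interval n x = ⋃ a : Fin 2, interval (n + 1) (Function.update x n a) := by
  ext y
  simp only [interval, Set.mem_ofPred_eq, Set.mem_iUnion]
  constructor
  · intro h
    refine ⟨y n, fun i hi => ?_⟩
    rcases eq_or_ne i n with rfl | hne
    · simp
    · rw [Function.update_of_ne hne]
      exact h i (by omega)
  · rintro ⟨a, h⟩ i hi
    have h1 := h i (by omega)
    rwa [Function.update_of_ne (by omega)] at h1

theorem dyadicAlgebra_mono : Monotone dyadicAlgebra := by
  refine monotone_nat_of_le_succ fun n => ?_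
  refine MeasurableSpace.generateFrom_le ?_
  rintro _ ⟨x, rfl⟩
  rw [interval_eq_iUnion]
  exact MeasurableSet.iUnion fun a => MeasurableSpace.measurableSet_generateFrom ⟨_, rfl⟩

/-- The dyadic filtration. -/
def dyadicFiltration : Filtration ℕ (MeasurableSpace.pi : MeasurableSpace G) where
  seq := dyadicAlgebra
  mono' := dyadicAlgebra_mono
  le' := dyadicAlgebra_le

/-- The Rademacher functions `r_k(x) = exp(2πi x_k / 2) = (-1) ^ x_k`. -/
def rademacher (k : ℕ) (x : G) : ℂ := (-1) ^ (x k : ℕ)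

/-- The Walsh-Paley functions `w_n = ∏ k, r_k ^ n_k`, where `n_k = n / 2 ^ k % 2` is the `k`-th
binary digit of `n`; as `n < 2 ^ n`, the digits with `k ≥ n` are zero. -/
def walsh (n : ℕ) (x : G) : ℂ := ∏ k ∈ Finset.range n, rademacher k x ^ (n / 2 ^ k % 2)

/-- The `L_p` quasi-norm of a nonnegative function. -/
def lpQuasiNorm (p : ℝ) (g : G → ℝ≥0∞) : ℝ≥0∞ := (∫⁻ x, g x ^ p ∂haar) ^ (1 / p)

/-- The weak `L_p` quasi-norm of a function. -/
def weakLpNorm (p : ℝ) (g : G → ℂ) : ℝ≥0∞ :=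
  (⨆ (t : ℝ≥0) (_ : 0 < t), (t : ℝ≥0∞) ^ p * haar {x | (t : ℝ≥0∞) < ‖g x‖ₑ}) ^ (1 / p)

/-- The maximal function of a sequence of functions. -/
def maximalFn (f : ℕ → G → ℂ) (x : G) : ℝ≥0∞ := ⨆ n, ‖f n x‖ₑ

/-- The Hardy space quasi-norm of a martingale: the `L_p` quasi-norm of its maximal function. -/
def hpNorm (p : ℝ) (f : ℕ → G → ℂ) : ℝ≥0∞ := lpQuasiNorm p (maximalFn f)

/-- Membership in the martingale Hardy space `H_p`. -/
def MemHp (p : ℝ) (f : ℕ → G → ℂ) : Prop :=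
  Martingale f dyadicFiltration haar ∧ hpNorm p f < ∞

/-- The dyadic martingale of an integrable function `g`: its `n`-th term at `x` is the mean value
of `g` over `I_n(x)`. -/
def toMartingale (g : G → ℂ) (n : ℕ) (x : G) : ℂ := ⨍ u in interval n x, g u ∂haar

/-- The Walsh-Fourier coefficients of a martingale (for a martingale the sequence under the limit
is eventually constant). -/
def fourierCoeff (f : ℕ → G → ℂ) (i : ℕ) : ℂ :=
  limUnder atTop fun k : ℕ => ∫ x, f k x * star (walsh i x) ∂haar

/-- The partial sums `S_n f = ∑ k < n, f̂(k) w_k`. -/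
def partialSum (n : ℕ) (f : ℕ → G → ℂ) (x : G) : ℂ :=
  ∑ k ∈ Finset.range n, fourierCoeff f k * walsh k x

/-- The Fejér means `σ_n f = (S_1 f + ⋯ + S_n f) / n`. -/
def fejer (n : ℕ) (f : ℕ → G → ℂ) (x : G) : ℂ :=
  (1 / (n : ℂ)) * ∑ k ∈ Finset.Icc 1 n, partialSum k f x

/-- Sharpness of the rate `R k` for the Fejér means with the indices `N k`: along every positive
nondecreasing `Φ` with `limsup R k / Φ (N k) = ∞`, some martingale in `H_p` has
`sup ‖σ_(N k) f / Φ (N k)‖ = ∞` in weak `L_p`. -/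
def SharpRate (p : ℝ) (N : ℕ → ℕ) (R : ℕ → ℝ) : Prop :=
  ∀ Φ : ℕ → ℝ, Monotone Φ → (∀ n, 0 < Φ n) →
    limsup (fun k : ℕ => ENNReal.ofReal (R k / Φ (N k))) atTop = ∞ →
    ∃ f : ℕ → G → ℂ, MemHp p f ∧
      ⨆ k : ℕ, weakLpNorm p (fun x => fejer (N k) f x / (Φ (N k) : ℂ)) = ∞

end WalshFejer

end

open WalshFejer

/-! Both index sequences have the form `N = 2 ^ n + 2 ^ s` with `s ≤ n`, and everything reduces to
the rate `2 ^ ((1 / p - 2) * (n - s))`. A dyadic martingale is the sequence of sums `dyadicSum c n`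
of one Walsh series, so `σ_N` is the multiplier `(N - i) / N`. Since `w_(2 ^ n + i) = r_n w_i` for
`i < 2 ^ n`, it splits into a head of order `2 ^ n` and `r_n 2 ^ s / N` times a Fejér mean of order
`2 ^ s` of the shifted coefficients (`fejer_two_pow_add_two_pow`).

Upper bound: writing `i` in binary turns the multiplier `i` into a combination of coordinate flips
(`index_mul_walsh`), so such means are dominated by geometrically weighted translates, which are
bounded in `L_p`. The head is thus controlled by the maximal function. In the tail, lowering the
order from `n` to `s` by averaging costs `2 ^ (1 - p)` per step in the `p`-th power, because `p <
1`, while the prefactor gains `2 ^ (-p)`; together this is `2 ^ ((1 - 2 * p) * (n - s))`.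

Sharpness: a lacunary sum of multiples of the atoms `2 ^ ((1 / p - 1) * a) r_a D_(2 ^ a)` lies in
`H_p`. On `I_s(0)` the tail of its Fejér mean is `r_n` times a large constant, and the head, being
invariant under the flip of coordinate `n`, cannot cancel it at both `x` and `flip n x`
(`le_weakLpNorm_of_flip`). -/

noncomputable section

namespace WalshFejer

/-! ### Coordinate flips and Walsh polynomials -/

/-- Translation by the `k`-th coordinate vector. -/
def flip (k : ℕ) (x : G) : G := Function.update x k (x k + 1)

theorem fin_two_add_one_add_one (a : Fin 2) : a + 1 + 1 = a := by
  revert a; decide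

theorem flip_flip (k : ℕ) (x : G) : flip k (flip k x) = x := by
  simp [flip, fin_two_add_one_add_one]

theorem flip_apply_of_ne {k i : ℕ} (h : i ≠ k) (x : G) : flip k x i = x i := by
  simp [flip, h]

theorem rademacher_flip (k t : ℕ) (x : G) :
    rademacher k (flip t x) = (if k = t then -1 else 1) * rademacher k x := by
  split_ifs with h
  · subst h
    have : ∀ a : Fin 2, (-1 : ℂ) ^ ((a + 1 : Fin 2) : ℕ) = -1 * (-1) ^ (a : ℕ) := by
      intro a; fin_cases a <;> simp
    simpa [rademacher, flip] using this (x k)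
  · simp [rademacher, flip_apply_of_ne h]

theorem rademacher_mul_self (k : ℕ) (x : G) : rademacher k x * rademacher k x = 1 := by
  rw [rademacher, ← mul_pow]; simp

theorem norm_rademacher (k : ℕ) (x : G) : ‖rademacher k x‖ = 1 := by
  simp [rademacher]

theorem digit_eq_zero {i n : ℕ} (h : i < 2 ^ n) {k : ℕ} (hk : n ≤ k) : i / 2 ^ k % 2 = 0 := by
  rw [Nat.div_eq_of_lt (h.trans_le (Nat.pow_le_pow_right two_pos hk))]

theorem walsh_eq_prod {i m : ℕ} (h : i < 2 ^ m) (x : G) :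
    walsh i x = ∏ k ∈ Finset.range m, rademacher k x ^ (i / 2 ^ k % 2) := by
  have key : ∀ a b : ℕ, a ≤ b → i < 2 ^ a →
      ∏ k ∈ Finset.range a, rademacher k x ^ (i / 2 ^ k % 2) =
        ∏ k ∈ Finset.range b, rademacher k x ^ (i / 2 ^ k % 2) := by
    intro a b hab ha
    refine Finset.prod_subset (Finset.range_mono hab) fun k _ hk => ?_
    rw [digit_eq_zero ha (by simpa using hk), pow_zero]
  rcases le_total i m with him | him
  · exact key i m him Nat.lt_two_pow_self
  · exact (key m i him h).symm

theorem walsh_zero (x : G) : walsh 0 x = 1 := by simp [walsh]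

theorem walsh_two_pow_add {n i : ℕ} (h : i < 2 ^ n) (x : G) :
    walsh (2 ^ n + i) x = rademacher n x * walsh i x := by
  have h1 : 2 ^ n + i < 2 ^ (n + 1) := by rw [pow_succ]; omega
  rw [walsh_eq_prod h1, walsh_eq_prod h, Finset.prod_range_succ, mul_comm]
  have h2 : (2 ^ n + i) / 2 ^ n % 2 = 1 := by
    rw [Nat.add_div_left _ (by positivity), Nat.div_eq_of_lt h]
  rw [h2, pow_one]
  congr 1
  refine Finset.prod_congr rfl fun k hk => ?_
  have hk := Finset.mem_range.1 hk
  obtain ⟨d, rfl⟩ := Nat.exists_eq_add_of_lt hk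
  have h3 : (2 ^ (k + d + 1) + i) / 2 ^ k = 2 * 2 ^ d + i / 2 ^ k := by
    rw [show 2 ^ (k + d + 1) = 2 ^ k * (2 * 2 ^ d) by ring, Nat.mul_add_div (by positivity)]
  rw [h3, Nat.mul_add_mod]

theorem walsh_flip (i t : ℕ) (x : G) :
    walsh i (flip t x) = (-1) ^ (i / 2 ^ t % 2) * walsh i x := by
  obtain ⟨m, hm, ht⟩ : ∃ m, i < 2 ^ m ∧ t < m :=
    ⟨i + t + 1, Nat.lt_two_pow_self.trans_le (Nat.pow_le_pow_right two_pos (by omega)), by omega⟩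
  rw [walsh_eq_prod hm, walsh_eq_prod hm]
  have : ∀ k, rademacher k (flip t x) ^ (i / 2 ^ k % 2) =
      (if k = t then (-1) ^ (i / 2 ^ k % 2) else 1) * rademacher k x ^ (i / 2 ^ k % 2) := by
    intro k
    rw [rademacher_flip, mul_pow]
    split_ifs <;> simp
  simp_rw [this]
  rw [Finset.prod_mul_distrib, Finset.prod_ite_eq' , if_pos (Finset.mem_range.2 ht)]

theorem norm_walsh (i : ℕ) (x : G) : ‖walsh i x‖ = 1 := by
  simp [walsh, norm_prod, norm_rademacher]

theorem walsh_mul_self (i : ℕ) (x : G) : walsh i x * walsh i x = 1 := by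
  rw [walsh, ← Finset.prod_mul_distrib]
  refine Finset.prod_eq_one fun k _ => ?_
  rw [← mul_pow, rademacher_mul_self, one_pow]

theorem star_walsh (i : ℕ) (x : G) : star (walsh i x) = walsh i x := by
  simp [walsh, rademacher]

theorem measurable_rademacher (k : ℕ) : Measurable (rademacher k) :=
  (measurable_from_top (f := fun a : Fin 2 => (-1 : ℂ) ^ (a : ℕ))).comp (measurable_pi_apply k)

theorem measurable_walsh (i : ℕ) : Measurable (walsh i) :=
  Finset.measurable_fun_prod _ fun k _ => (measurable_rademacher k).pow_const _

/-- The Walsh functions of index below `2 ^ n` are constant on the dyadic intervals `I_n(x)`. -/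
theorem walsh_congr {i n : ℕ} (h : i < 2 ^ n) {x y : G} (hxy : y ∈ interval n x) :
    walsh i y = walsh i x := by
  rw [walsh_eq_prod h, walsh_eq_prod h]
  refine Finset.prod_congr rfl fun k hk => ?_
  rw [rademacher, rademacher, hxy k (Finset.mem_range.1 hk)]

theorem sum_two_pow_mul_digit (i m : ℕ) :
    ∑ t ∈ Finset.range m, 2 ^ t * (i / 2 ^ t % 2) = i % 2 ^ m := by
  induction m with
  | zero => simp [Nat.mod_one]
  | succ m ih => rw [Finset.sum_range_succ, ih, Nat.mod_pow_succ]

/-- Flipping coordinate `t` multiplies `w_i` by `(-1)` to the `t`-th binary digit of `i`, so half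
the difference extracts that digit. This replaces any computation of Fejér kernels. -/
theorem index_mul_walsh {i m : ℕ} (h : i < 2 ^ m) (x : G) :
    (i : ℂ) * walsh i x =
      ∑ t ∈ Finset.range m, (2 : ℂ) ^ t / 2 * (walsh i x - walsh i (flip t x)) := by
  have h1 : (i : ℂ) = ∑ t ∈ Finset.range m, (2 : ℂ) ^ t * ((i / 2 ^ t % 2 : ℕ) : ℂ) := by
    have := sum_two_pow_mul_digit i m
    rw [Nat.mod_eq_of_lt h] at this
    conv_lhs => rw [← this]
    push_cast
    rfl
  conv_lhs => rw [h1, Finset.sum_mul]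
  refine Finset.sum_congr rfl fun t _ => ?_
  rw [walsh_flip]
  rcases Nat.mod_two_eq_zero_or_one (i / 2 ^ t) with h | h <;> rw [h] <;> simp
  ring

/-- The Walsh polynomial with coefficients `c i` for `i < 2 ^ n`. -/
def dyadicSum (c : ℕ → ℂ) (n : ℕ) (x : G) : ℂ :=
  ∑ i ∈ Finset.range (2 ^ n), c i * walsh i x

theorem dyadicSum_succ (c : ℕ → ℂ) (n : ℕ) (x : G) :
    dyadicSum c (n + 1) x =
      dyadicSum c n x + rademacher n x * dyadicSum (fun i => c (2 ^ n + i)) n x := by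
  rw [dyadicSum, pow_succ, mul_two, Finset.sum_range_add, dyadicSum, dyadicSum, Finset.mul_sum]
  congr 1
  refine Finset.sum_congr rfl fun i hi => ?_
  rw [walsh_two_pow_add (Finset.mem_range.1 hi)]
  ring

theorem dyadicSum_congr (c : ℕ → ℂ) {m n : ℕ} (hmn : m ≤ n) {x y : G} (hxy : y ∈ interval n x) :
    dyadicSum c m y = dyadicSum c m x :=
  Finset.sum_congr rfl fun i hi => by
    rw [walsh_congr ((Finset.mem_range.1 hi).trans_le (Nat.pow_le_pow_right two_pos hmn)) hxy]

theorem flip_mem_interval {m k : ℕ} (h : m ≤ k) (x : G) : flip k x ∈ interval m x :=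
  fun i hi => flip_apply_of_ne (by omega) x

theorem dyadicSum_flip (c : ℕ → ℂ) {m k : ℕ} (h : m ≤ k) (x : G) :
    dyadicSum c m (flip k x) = dyadicSum c m x :=
  dyadicSum_congr c le_rfl (flip_mem_interval h x)

theorem dyadicSum_eq_average (c : ℕ → ℂ) (n : ℕ) (x : G) :
    dyadicSum c n x = (dyadicSum c (n + 1) x + dyadicSum c (n + 1) (flip n x)) / 2 := by
  rw [dyadicSum_succ, dyadicSum_succ, dyadicSum_flip _ le_rfl, dyadicSum_flip _ le_rfl,
    rademacher_flip, if_pos rfl]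
  ring

theorem measurable_dyadicSum (c : ℕ → ℂ) (n : ℕ) : Measurable (dyadicSum c n) :=
  Finset.measurable_fun_sum _ fun i _ => (measurable_walsh i).const_mul _

theorem sum_index_mul_walsh (c : ℕ → ℂ) (m : ℕ) (x : G) :
    ∑ i ∈ Finset.range (2 ^ m), (i : ℂ) * (c i * walsh i x) =
      ∑ t ∈ Finset.range m,
        (2 : ℂ) ^ t / 2 * (dyadicSum c m x - dyadicSum c m (flip t x)) := by
  simp_rw [dyadicSum, ← Finset.sum_sub_distrib, Finset.mul_sum]
  rw [Finset.sum_comm]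
  refine Finset.sum_congr rfl fun i hi => ?_
  rw [mul_left_comm, index_mul_walsh (Finset.mem_range.1 hi), Finset.mul_sum]
  refine Finset.sum_congr rfl fun t _ => ?_
  ring

/-! ### The Haar measure -/

instance : IsProbabilityMeasure haar := by
  unfold haar; infer_instance

theorem haar_interval (n : ℕ) (x : G) : haar (interval n x) = (2 ^ n)⁻¹ := by
  have h : interval n x = Set.pi (Finset.range n : Set ℕ) fun i => {x i} := by
    ext y; simp [interval, Set.mem_pi]
  rw [h, haar, Measure.infinitePi_pi _ fun i _ => measurableSet_singleton _]
  simp [ENNReal.inv_pow]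

theorem measurePreserving_flip (k : ℕ) : MeasurePreserving (flip k) haar haar := by
  have h : flip k = fun x i => (if i = k then (fun a : Fin 2 => a + 1) else id) (x i) := by
    ext x i
    by_cases hi : i = k
    · subst hi; simp [flip]
    · simp [flip, hi]
  have hm : Measurable (flip k) := by
    rw [h]
    exact measurable_pi_lambda _ fun i => (measurable_of_finite _).comp (measurable_pi_apply i)
  refine ⟨hm, ?_⟩
  rw [haar, h, Measure.infinitePi_map_pi _ fun i => measurable_of_finite _]
  congr 1
  ext1 i
  have : MeasurePreserving (if i = k then (fun a : Fin 2 => a + 1) else id)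
      (PMF.uniformOfFintype (Fin 2)).toMeasure (PMF.uniformOfFintype (Fin 2)).toMeasure := by
    refine ⟨measurable_of_finite _, ?_⟩
    refine Measure.ext_of_singleton fun a => ?_
    rw [Measure.map_apply (measurable_of_finite _) (measurableSet_singleton _)]
    split_ifs
    · have : (fun a : Fin 2 => a + 1) ⁻¹' {a} = {a + 1} := by
        have h2 : ∀ a b : Fin 2, b + 1 = a ↔ b = a + 1 := by decide
        ext b
        exact h2 a b
      rw [this]
      simp
    · simp
  exact this.map_eq

/-! ### Walsh expansions of dyadic martingales -/

/-- Translation by the `k`-th coordinate vector as a measurable equivalence. -/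
def flipEquiv (k : ℕ) : G ≃ᵐ G where
  toFun := flip k
  invFun := flip k
  left_inv := flip_flip k
  right_inv := flip_flip k
  measurable_toFun := (measurePreserving_flip k).measurable
  measurable_invFun := (measurePreserving_flip k).measurable

/-- The source of all orthogonality below: flips preserve `haar`. -/
theorem integral_eq_zero_of_flip_neg {F : G → ℂ} (k : ℕ) (h : ∀ x, F (flip k x) = -F x) :
    ∫ x, F x ∂haar = 0 := by
  have h1 : ∫ x, F (flip k x) ∂haar = ∫ x, F x ∂haar :=
    (measurePreserving_flip k).integral_comp (flipEquiv k).measurableEmbedding F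
  simp_rw [h, integral_neg] at h1
  exact self_eq_neg.1 h1.symm

theorem log_digit {i : ℕ} (h : i ≠ 0) : i / 2 ^ Nat.log 2 i % 2 = 1 := by
  have h1 : i / 2 ^ Nat.log 2 i = 1 := by
    refine Nat.div_eq_of_lt_le ?_ ?_
    · simpa using Nat.pow_log_le_self 2 h
    · have := Nat.lt_pow_succ_log_self one_lt_two i
      rw [pow_succ] at this
      omega
  rw [h1]

theorem setIntegral_walsh_eq_zero {n i : ℕ} (h : 2 ^ n ≤ i) {S : Set G} (hS : MeasurableSet S)
    (hinv : ∀ x y, y ∈ interval n x → (y ∈ S ↔ x ∈ S)) : ∫ x in S, walsh i x ∂haar = 0 := by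
  have hi : i ≠ 0 := by have := Nat.two_pow_pos n; omega
  have hn : n ≤ Nat.log 2 i := Nat.le_log_of_pow_le one_lt_two h
  rw [← integral_indicator hS]
  -- The top binary digit of `i` sits at a position at least `n`: flipping there negates `w_i` but
  -- preserves `S`.
  refine integral_eq_zero_of_flip_neg (Nat.log 2 i) fun x => ?_
  have h1 := hinv x _ (flip_mem_interval hn x)
  by_cases hx : x ∈ S
  · rw [Set.indicator_of_mem hx, Set.indicator_of_mem (h1.2 hx), walsh_flip, log_digit hi]
    simp
  · rw [Set.indicator_of_notMem hx, Set.indicator_of_notMem (fun h => hx (h1.1 h)), neg_zero]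

theorem exists_digit_ne {i j : ℕ} (h : i ≠ j) : ∃ t, i / 2 ^ t % 2 ≠ j / 2 ^ t % 2 := by
  by_contra! hd
  have hi : i < 2 ^ (i + j) := Nat.lt_two_pow_self.trans_le (Nat.pow_le_pow_right two_pos (by omega))
  have hj : j < 2 ^ (i + j) := Nat.lt_two_pow_self.trans_le (Nat.pow_le_pow_right two_pos (by omega))
  refine h ?_
  have h1 := sum_two_pow_mul_digit i (i + j)
  have h2 := sum_two_pow_mul_digit j (i + j)
  rw [Nat.mod_eq_of_lt hi] at h1
  rw [Nat.mod_eq_of_lt hj] at h2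
  refine h1.symm.trans (Eq.trans ?_ h2)
  exact Finset.sum_congr rfl fun t _ => by rw [hd]

theorem integral_walsh_mul_walsh (i j : ℕ) :
    ∫ x, walsh i x * walsh j x ∂haar = if i = j then 1 else 0 := by
  split_ifs with h
  · subst h; simp [walsh_mul_self]
  · obtain ⟨t, ht⟩ := exists_digit_ne h
    refine integral_eq_zero_of_flip_neg t fun x => ?_
    rw [walsh_flip, walsh_flip]
    rcases Nat.mod_two_eq_zero_or_one (i / 2 ^ t) with h1 | h1 <;>
      rcases Nat.mod_two_eq_zero_or_one (j / 2 ^ t) with h2 | h2 <;> simp_all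

theorem integrable_of_bounded {g : G → ℂ} (hg : Measurable g) {C : ℝ} (hC : ∀ x, ‖g x‖ ≤ C) :
    Integrable g haar :=
  Integrable.of_bound hg.aestronglyMeasurable C (ae_of_all _ hC)

theorem integrable_walsh (i : ℕ) : Integrable (walsh i) haar :=
  integrable_of_bounded (measurable_walsh i) fun x => (norm_walsh i x).le

theorem integrable_dyadicSum (c : ℕ → ℂ) (n : ℕ) : Integrable (dyadicSum c n) haar :=
  integrable_finsetSum _ fun i _ => (integrable_walsh i).const_mul _

theorem integral_dyadicSum_mul_walsh (c : ℕ → ℂ) {n i : ℕ} (h : i < 2 ^ n) :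
    ∫ x, dyadicSum c n x * star (walsh i x) ∂haar = c i := by
  simp_rw [star_walsh, dyadicSum, Finset.sum_mul, mul_assoc]
  rw [integral_finsetSum]
  · simp_rw [integral_const_mul, integral_walsh_mul_walsh]
    simp [h]
  · intro j _
    refine (integrable_of_bounded (C := 1) ((measurable_walsh j).mul (measurable_walsh i))
      fun x => ?_).const_mul _
    simp [norm_walsh]

theorem setIntegral_walsh_interval {i n : ℕ} (h : i < 2 ^ n) (x : G) :
    ∫ y in interval n x, walsh i y ∂haar = (2 ^ n : ℂ)⁻¹ * walsh i x := by
  rw [setIntegral_congr_fun (g := fun _ => walsh i x) (measurableSet_interval n x)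
    fun y hy => walsh_congr h hy, setIntegral_const, measureReal_def, haar_interval]
  simp [Complex.real_smul]

theorem interval_congr {n : ℕ} {x y : G} (h : y ∈ interval n x) (z : G) :
    y ∈ interval n z ↔ x ∈ interval n z :=
  forall₂_congr fun i hi => by rw [h i hi]

theorem setIntegral_walsh_interval_of_le {i n : ℕ} (h : 2 ^ n ≤ i) (x : G) :
    ∫ y in interval n x, walsh i y ∂haar = 0 :=
  setIntegral_walsh_eq_zero h (measurableSet_interval n x) fun _ _ h => interval_congr h x

/-- The martingale of a Walsh polynomial is obtained by truncation. -/
theorem toMartingale_walsh_sum (c : ℕ → ℂ) (s : Finset ℕ) (n : ℕ) (x : G) :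
    toMartingale (fun y => ∑ i ∈ s, c i * walsh i y) n x =
      ∑ i ∈ s with i < 2 ^ n, c i * walsh i x := by
  rw [toMartingale, setAverage_eq, measureReal_def, haar_interval,
    integral_finsetSum _ fun i _ => ((integrable_walsh i).const_mul _).integrableOn,
    Finset.sum_filter, Finset.smul_sum]
  refine Finset.sum_congr rfl fun i _ => ?_
  rw [integral_const_mul]
  split_ifs with h
  · rw [setIntegral_walsh_interval h]
    simp [Complex.real_smul]
    field_simp
  · rw [setIntegral_walsh_interval_of_le (not_lt.1 h)]
    simp

theorem mem_congr_of_measurableSet_dyadicAlgebra {n : ℕ} {S : Set G}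
    (hS : MeasurableSet[dyadicAlgebra n] S) : ∀ x y, y ∈ interval n x → (y ∈ S ↔ x ∈ S) := by
  induction S, hS using MeasurableSpace.generateFrom_induction with
  | hC t ht _ =>
    obtain ⟨z, rfl⟩ := ht
    exact fun x y h => interval_congr h z
  | empty => simp
  | compl t _ ih => exact fun x y h => not_congr (ih x y h)
  | iUnion s _ ih =>
    intro x y h
    simp only [Set.mem_iUnion]
    exact exists_congr fun k => ih k x y h

theorem finite_range_interval (n : ℕ) : (Set.range (interval n)).Finite := by
  refine (Set.finite_range fun z : Fin n → Fin 2 =>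
    interval n fun i => if h : i < n then z ⟨i, h⟩ else 0).subset ?_
  rintro _ ⟨x, rfl⟩
  refine ⟨fun i => x i, ?_⟩
  ext y
  refine forall₂_congr fun i hi => ?_
  simp [hi]

theorem measurableSet_dyadicAlgebra {n : ℕ} {S : Set G}
    (hS : ∀ x y, y ∈ interval n x → (y ∈ S ↔ x ∈ S)) : MeasurableSet[dyadicAlgebra n] S := by
  have h : S = ⋃₀ (interval n '' S) := by
    ext y
    simp only [Set.sUnion_image, Set.mem_iUnion, exists_prop]
    exact ⟨fun hy => ⟨y, hy, fun _ _ => rfl⟩, fun ⟨x, hx, hy⟩ => (hS x y hy).2 hx⟩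
  rw [h]
  refine MeasurableSet.sUnion
    ((finite_range_interval n).subset (Set.image_subset_range _ _)).countable ?_
  rintro _ ⟨x, _, rfl⟩
  exact MeasurableSpace.measurableSet_generateFrom ⟨x, rfl⟩

theorem stronglyMeasurable_dyadicAlgebra_iff {n : ℕ} {f : G → ℂ} :
    StronglyMeasurable[dyadicAlgebra n] f ↔ ∀ x y, y ∈ interval n x → f y = f x := by
  constructor
  · intro hf x y h
    have h1 := hf.measurable (measurableSet_singleton (f x))
    exact (mem_congr_of_measurableSet_dyadicAlgebra h1 x y h).2 rfl
  · intro h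
    have hm : Measurable[dyadicAlgebra n] f := fun t _ =>
      measurableSet_dyadicAlgebra fun x y hxy => by simp [h x y hxy]
    exact hm.stronglyMeasurable

/-- Induction on `n`: the even part of `f` under `flip n`, and `r_n` times the odd part, depend on
the first `n` coordinates only; they supply the lower and the upper half of the coefficients. -/
theorem exists_eq_dyadicSum {n : ℕ} {f : G → ℂ} (h : ∀ x y, y ∈ interval n x → f y = f x) :
    ∃ c, f = dyadicSum c n := by
  induction n generalizing f with
  | zero =>
    refine ⟨fun _ => f 0, funext fun x => ?_⟩
    simp [dyadicSum, walsh_zero, h 0 x (fun i hi => absurd hi (by omega))]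
  | succ n ih =>
    have hcase : ∀ x y, y ∈ interval n x → y ∈ interval (n + 1) x ∨
        (y ∈ interval (n + 1) (flip n x) ∧ flip n y ∈ interval (n + 1) x) := by
      intro x y hy
      by_cases hn : y n = x n
      · refine Or.inl fun i hi => ?_
        rcases Nat.lt_succ_iff_lt_or_eq.1 hi with hi | rfl
        exacts [hy i hi, hn]
      · have hn' : ∀ a b : Fin 2, a ≠ b → a = b + 1 := by decide
        refine Or.inr ⟨fun i hi => ?_, fun i hi => ?_⟩ <;>
          rcases Nat.lt_succ_iff_lt_or_eq.1 hi with hi | rfl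
        · rw [hy i hi, flip_apply_of_ne hi.ne]
        · simpa [flip] using hn' _ _ hn
        · rw [flip_apply_of_ne hi.ne, hy i hi]
        · simpa [flip] using (hn' _ _ (Ne.symm hn)).symm
    have hflip : ∀ x y, y ∈ interval (n + 1) x → flip n y ∈ interval (n + 1) (flip n x) := by
      intro x y hy i hi
      by_cases h : i = n
      · subst h; simp [flip, hy i hi]
      · rw [flip_apply_of_ne h, flip_apply_of_ne h, hy i hi]
    obtain ⟨a, ha⟩ := ih (f := fun x => (f x + f (flip n x)) / 2) <| by
      intro x y hy
      rcases hcase x y hy with h1 | ⟨h1, h2⟩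
      · simp only [h x y h1, h _ _ (hflip x y h1)]
      · simp only [h _ _ h1, h _ _ h2, add_comm]
    obtain ⟨b, hb⟩ := ih (f := fun x => rademacher n x * ((f x - f (flip n x)) / 2)) <| by
      intro x y hy
      rcases hcase x y hy with h1 | ⟨h1, h2⟩
      · have : rademacher n y = rademacher n x := by rw [rademacher, rademacher, h1 n (by omega)]
        simp only [h x y h1, h _ _ (hflip x y h1), this]
      · have : rademacher n y = -rademacher n x := by
          rw [rademacher, h1 n (by omega), ← rademacher, rademacher_flip, if_pos rfl]; ring
        simp only [h _ _ h1, h _ _ h2, this]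
        ring
    refine ⟨fun i => if i < 2 ^ n then a i else b (i - 2 ^ n), funext fun x => ?_⟩
    have h1 : dyadicSum (fun i => if i < 2 ^ n then a i else b (i - 2 ^ n)) n x =
        dyadicSum a n x :=
      Finset.sum_congr rfl fun i hi => by simp only [if_pos (Finset.mem_range.1 hi)]
    rw [dyadicSum_succ, h1]
    simp only [add_lt_iff_neg_left, not_lt_zero, if_false, add_tsub_cancel_left]
    change _ = _ + _ * dyadicSum b n x
    rw [← ha, ← hb, ← mul_assoc, rademacher_mul_self]
    ring

theorem toMartingale_dyadicSum (c : ℕ → ℂ) {m n : ℕ} (h : m ≤ n) (x : G) :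
    toMartingale (dyadicSum c n) m x = dyadicSum c m x := by
  have := toMartingale_walsh_sum c (Finset.range (2 ^ n)) m x
  rw [show dyadicSum c n = fun y => ∑ i ∈ Finset.range (2 ^ n), c i * walsh i y from rfl, this,
    dyadicSum]
  congr 1
  ext i
  have := Nat.pow_le_pow_right two_pos h
  simp only [Finset.mem_filter, Finset.mem_range]
  omega

theorem toMartingale_of_congr {n : ℕ} {f : G → ℂ} (h : ∀ x y, y ∈ interval n x → f y = f x)
    (x : G) : toMartingale f n x = f x := by
  obtain ⟨c, rfl⟩ := exists_eq_dyadicSum h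
  exact toMartingale_dyadicSum c le_rfl x

/-- A sequence of Walsh polynomials with common coefficients is a martingale. -/
theorem martingale_dyadicSum (c : ℕ → ℂ) : Martingale (dyadicSum c) dyadicFiltration haar := by
  refine martingale_of_setIntegral_eq_succ
    (fun n => stronglyMeasurable_dyadicAlgebra_iff.2 fun x y h => dyadicSum_congr c le_rfl h)
    (integrable_dyadicSum c) fun n S hS => ?_
  have hS' : MeasurableSet S := dyadicAlgebra_le n S hS
  rw [← sub_eq_zero, ← integral_sub (integrable_dyadicSum c n).integrableOn
    (integrable_dyadicSum c (n + 1)).integrableOn]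
  have h : ∀ x, dyadicSum c n x - dyadicSum c (n + 1) x =
      ∑ i ∈ Finset.range (2 ^ n), -c (2 ^ n + i) * walsh (2 ^ n + i) x := by
    intro x
    rw [dyadicSum, dyadicSum, pow_succ, mul_two, Finset.sum_range_add]
    simp
  simp_rw [h]
  rw [integral_finsetSum _ fun i _ => ((integrable_walsh _).const_mul _).integrableOn]
  refine Finset.sum_eq_zero fun i _ => ?_
  rw [integral_const_mul, setIntegral_walsh_eq_zero (Nat.le_add_right _ i) hS'
    (mem_congr_of_measurableSet_dyadicAlgebra hS), mul_zero]

theorem fourierCoeff_dyadicSum (c : ℕ → ℂ) (i : ℕ) : fourierCoeff (dyadicSum c) i = c i := by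
  refine Tendsto.limUnder_eq ?_
  refine tendsto_const_nhds.congr' ?_
  filter_upwards [eventually_ge_atTop i] with k hk
  exact (integral_dyadicSum_mul_walsh c
    (Nat.lt_two_pow_self.trans_le (Nat.pow_le_pow_right two_pos hk))).symm

/-- Every dyadic martingale consists of the dyadic partial sums of a Walsh series. -/
theorem exists_coeff_of_martingale {f : ℕ → G → ℂ} (hf : Martingale f dyadicFiltration haar) :
    ∃ c, f = dyadicSum c := by
  have hfn : ∀ n, ∃ c, f n = dyadicSum c n := fun n =>
    exists_eq_dyadicSum (stronglyMeasurable_dyadicAlgebra_iff.1 (hf.stronglyMeasurable n))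
  choose C hC using hfn
  have hmart : ∀ m n, m ≤ n → f m = dyadicSum (C n) m := by
    intro m n hmn
    ext x
    rw [← toMartingale_of_congr
      (stronglyMeasurable_dyadicAlgebra_iff.1 (hf.stronglyMeasurable m)) x,
      ← toMartingale_dyadicSum (C n) hmn, ← hC n, toMartingale, toMartingale, setAverage_eq,
      setAverage_eq, hf.setIntegral_eq hmn
        (MeasurableSpace.measurableSet_generateFrom ⟨x, rfl⟩ :
          MeasurableSet[dyadicAlgebra m] (interval m x))]
  -- As `i < 2 ^ (i + 1)`, stage `i + 1` already determines coefficient `i`, and later stages agree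
  -- with it.
  refine ⟨fun i => C (i + 1) i, funext fun n => ?_⟩
  rw [hC n]
  ext x
  refine Finset.sum_congr rfl fun i hi => ?_
  have hi := Finset.mem_range.1 hi
  have key : ∀ m k, i < 2 ^ m → m ≤ k → C m i = C k i := by
    intro m k hm hmk
    rw [← integral_dyadicSum_mul_walsh (C m) hm, ← integral_dyadicSum_mul_walsh (C k) hm,
      ← hC m, hmart m k hmk]
  congr 1
  have hi1 : i < 2 ^ (i + 1) := Nat.lt_two_pow_self.trans_le
    (Nat.pow_le_pow_right two_pos (by omega))
  rcases le_total n (i + 1) with h | h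
  exacts [key n _ hi h, (key _ n hi1 h).symm]

theorem fejer_dyadicSum (c : ℕ → ℂ) {N : ℕ} (hN : N ≠ 0) (x : G) :
    fejer N (dyadicSum c) x =
      ∑ i ∈ Finset.range N, (((N : ℂ) - i) / N * c i) * walsh i x := by
  have h : ∀ n : ℕ, ∑ k ∈ Finset.Icc 1 n, ∑ i ∈ Finset.range k, c i * walsh i x =
      ∑ i ∈ Finset.range n, ((n : ℂ) - i) * (c i * walsh i x) := by
    intro n
    induction n with
    | zero => simp
    | succ n ih =>
      rw [Finset.sum_Icc_succ_top (by omega), ih, Finset.sum_range_succ (n := n),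
        Finset.sum_range_succ (n := n), ← add_assoc, ← Finset.sum_add_distrib]
      push_cast
      congr 1
      · exact Finset.sum_congr rfl fun i _ => by ring
      · ring
  simp only [fejer, partialSum, fourierCoeff_dyadicSum]
  rw [h, Finset.mul_sum]
  refine Finset.sum_congr rfl fun i _ => ?_
  have : (N : ℂ) ≠ 0 := by exact_mod_cast hN
  field_simp

/-! ### Upper bounds for the Fejér means -/

/-- The sum of translates that dominates the dyadic Fejér means of order `2 ^ s`. -/
def translateSum (s : ℕ) (φ : G → ℝ≥0∞) (x : G) : ℝ≥0∞ :=
  2 * φ x + ∑ t ∈ Finset.range s, 2⁻¹ ^ (s - t) * φ (flip t x)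

theorem translateSum_mono (s : ℕ) {φ ψ : G → ℝ≥0∞} (h : ∀ x, φ x ≤ ψ x) (x : G) :
    translateSum s φ x ≤ translateSum s ψ x := by
  unfold translateSum
  gcongr <;> apply h

/-- The constant in the `L_p` bound for `translateSum`. -/
def translateConst (p : ℝ) : ℝ≥0∞ := 2 ^ p + (1 - 2⁻¹ ^ p)⁻¹

theorem translateConst_ne_top {p : ℝ} (hp : 0 < p) : translateConst p ≠ ∞ := by
  refine ENNReal.add_ne_top.2 ⟨ENNReal.rpow_ne_top_of_nonneg hp.le (by simp), ?_⟩
  rw [ENNReal.inv_ne_top, ne_eq, tsub_eq_zero_iff_le, not_le]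
  exact ENNReal.rpow_lt_one (by simp) hp

theorem sum_rpow_le {ι : Type*} {p : ℝ} (hp : 0 < p) (hp1 : p ≤ 1) (s : Finset ι)
    (g : ι → ℝ≥0∞) : (∑ i ∈ s, g i) ^ p ≤ ∑ i ∈ s, g i ^ p :=
  Finset.le_sum_of_subadditive (fun a : ℝ≥0∞ => a ^ p) (ENNReal.zero_rpow_of_pos hp).le
    (fun a b => ENNReal.rpow_add_le_add_rpow a b hp.le hp1) s g

/-- By subadditivity of the `p`-th power and invariance under flips, only a geometric series of
ratio `2 ^ (-p)` remains, so the constant does not depend on `s`. -/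
theorem lintegral_translateSum_rpow_le {p : ℝ} (hp : 0 < p) (hp1 : p ≤ 1) (s : ℕ)
    {φ : G → ℝ≥0∞} (hφ : Measurable φ) :
    ∫⁻ x, translateSum s φ x ^ p ∂haar ≤ translateConst p * ∫⁻ x, φ x ^ p ∂haar := by
  have hφp : Measurable fun x => φ x ^ p := hφ.pow_const p
  have hflip : ∀ t, ∫⁻ x, φ (flip t x) ^ p ∂haar = ∫⁻ x, φ x ^ p ∂haar := fun t =>
    (measurePreserving_flip t).lintegral_comp hφp
  have hflipm : ∀ t, Measurable fun x => φ (flip t x) ^ p := fun t =>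
    hφp.comp (measurePreserving_flip t).measurable
  calc ∫⁻ x, translateSum s φ x ^ p ∂haar
      ≤ ∫⁻ x, (2 ^ p * φ x ^ p +
          ∑ t ∈ Finset.range s, (2⁻¹ ^ p) ^ (s - t) * φ (flip t x) ^ p) ∂haar := by
        refine lintegral_mono fun x => ?_
        refine (ENNReal.rpow_add_le_add_rpow _ _ hp.le hp1).trans ?_
        rw [ENNReal.mul_rpow_of_nonneg _ _ hp.le]
        gcongr
        refine (sum_rpow_le hp hp1 _ _).trans (Finset.sum_le_sum fun t _ => ?_)
        rw [ENNReal.mul_rpow_of_nonneg _ _ hp.le, ← ENNReal.rpow_natCast, ← ENNReal.rpow_natCast,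
          ← ENNReal.rpow_mul, ← ENNReal.rpow_mul, mul_comm p]
    _ = (2 ^ p + ∑ t ∈ Finset.range s, (2⁻¹ ^ p) ^ (s - t)) * ∫⁻ x, φ x ^ p ∂haar := by
        rw [lintegral_add_left (hφp.const_mul _), lintegral_const_mul _ hφp,
          lintegral_finsetSum _ fun t _ => (hflipm t).const_mul _, add_mul, Finset.sum_mul]
        congr 1
        refine Finset.sum_congr rfl fun t _ => ?_
        rw [lintegral_const_mul _ (hflipm t), hflip]
    _ ≤ translateConst p * ∫⁻ x, φ x ^ p ∂haar := by
        unfold translateConst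
        gcongr
        have h1 : ∑ t ∈ Finset.range s, ((2⁻¹ : ℝ≥0∞) ^ p) ^ (s - t) =
            ∑ j ∈ Finset.range s, (2⁻¹ ^ p) ^ (j + 1) := by
          rw [← Finset.sum_range_reflect]
          refine Finset.sum_congr rfl fun j hj => ?_
          have := Finset.mem_range.1 hj
          congr 1
          omega
        rw [h1, ← ENNReal.tsum_geometric]
        refine (Finset.sum_le_sum fun j _ => ?_).trans (ENNReal.sum_le_tsum (Finset.range s))
        refine pow_le_pow_right_of_le_one' (ENNReal.rpow_le_one (by simp) hp.le) (Nat.le_succ j)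

/-- The weight is `1 - i / M`, and `index_mul_walsh` handles `i / M`. The coefficients `2 ^ t / (2 *
M)` sum to at most `1`, which gives the factor `2`, and each is at most `2⁻¹ ^ (n - t)`. -/
theorem norm_weighted_dyadicSum_le (c : ℕ → ℂ) {m n M : ℕ} (hmn : m ≤ n) (hM : 2 ^ n ≤ M)
    (x : G) :
    ‖∑ i ∈ Finset.range (2 ^ m), (((M : ℂ) - i) / M * c i) * walsh i x‖ ≤
      2 * ‖dyadicSum c m x‖ +
        ∑ t ∈ Finset.range n, 2⁻¹ ^ (n - t) * ‖dyadicSum c m (flip t x)‖ := by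
  have hM0 : (0 : ℝ) < M := by
    have := Nat.two_pow_pos n
    exact_mod_cast this.trans_le hM
  have hMc : (M : ℂ) ≠ 0 := by exact_mod_cast hM0.ne'
  have hMn : (2 : ℝ) ^ n ≤ M := by exact_mod_cast hM
  have h1 : ∑ i ∈ Finset.range (2 ^ m), (((M : ℂ) - i) / M * c i) * walsh i x =
      dyadicSum c m x - ∑ t ∈ Finset.range m,
        (2 : ℂ) ^ t / 2 / M * (dyadicSum c m x - dyadicSum c m (flip t x)) := by
    have h2 := congrArg (fun z => (M : ℂ)⁻¹ * z) (sum_index_mul_walsh c m x)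
    simp only [Finset.mul_sum] at h2
    have h3 : ∑ t ∈ Finset.range m,
        (2 : ℂ) ^ t / 2 / M * (dyadicSum c m x - dyadicSum c m (flip t x)) =
        ∑ i ∈ Finset.range (2 ^ m), (M : ℂ)⁻¹ * (i * (c i * walsh i x)) := by
      rw [h2]
      exact Finset.sum_congr rfl fun t _ => by ring
    rw [h3]
    conv_rhs => rw [dyadicSum, ← Finset.sum_sub_distrib]
    refine Finset.sum_congr rfl fun i _ => ?_
    field_simp
  have hcoef : ∀ t ∈ Finset.range m, (2 : ℝ) ^ t / 2 / M ≤ 2⁻¹ ^ (n - t) := by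
    intro t ht
    have ht' : t ≤ n := (Finset.mem_range.1 ht).le.trans hmn
    rw [inv_pow, div_div, div_le_iff₀ (by positivity), inv_mul_eq_div,
      le_div_iff₀ (by positivity), ← pow_add, Nat.add_sub_cancel' ht']
    linarith
  have hsum : ∑ t ∈ Finset.range m, (2 : ℝ) ^ t / 2 / M ≤ 1 := by
    rw [← Finset.sum_div, ← Finset.sum_div, geom_sum_eq (by norm_num), div_le_one hM0]
    have : (2 : ℝ) ^ m ≤ 2 ^ n := pow_le_pow_right₀ (by norm_num) hmn
    have : (0 : ℝ) < 2 ^ m := by positivity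
    linarith
  rw [h1]
  calc _ ≤ ‖dyadicSum c m x‖ + ∑ t ∈ Finset.range m,
        (2 : ℝ) ^ t / 2 / M * (‖dyadicSum c m x‖ + ‖dyadicSum c m (flip t x)‖) := by
        refine (norm_sub_le _ _).trans (add_le_add le_rfl ((norm_sum_le _ _).trans ?_))
        refine Finset.sum_le_sum fun t _ => ?_
        rw [norm_mul]
        have : ‖(2 : ℂ) ^ t / 2 / M‖ = (2 : ℝ) ^ t / 2 / M := by simp
        rw [this]
        gcongr
        exact norm_sub_le _ _
    _ = ‖dyadicSum c m x‖ + ((∑ t ∈ Finset.range m, (2 : ℝ) ^ t / 2 / M) * ‖dyadicSum c m x‖ +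
        ∑ t ∈ Finset.range m, (2 : ℝ) ^ t / 2 / M * ‖dyadicSum c m (flip t x)‖) := by
        simp_rw [mul_add, Finset.sum_add_distrib, Finset.sum_mul]
    _ ≤ ‖dyadicSum c m x‖ + (1 * ‖dyadicSum c m x‖ +
        ∑ t ∈ Finset.range m, 2⁻¹ ^ (n - t) * ‖dyadicSum c m (flip t x)‖) := by
        gcongr with t ht
        exact hcoef t ht
    _ ≤ ‖dyadicSum c m x‖ + (1 * ‖dyadicSum c m x‖ +
        ∑ t ∈ Finset.range n, 2⁻¹ ^ (n - t) * ‖dyadicSum c m (flip t x)‖) := by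
        gcongr
    _ = _ := by ring

theorem enorm_weighted_dyadicSum_le (c : ℕ → ℂ) {m n M : ℕ} (hmn : m ≤ n) (hM : 2 ^ n ≤ M)
    (x : G) :
    ‖∑ i ∈ Finset.range (2 ^ m), (((M : ℂ) - i) / M * c i) * walsh i x‖ₑ ≤
      translateSum n (fun y => ‖dyadicSum c m y‖ₑ) x := by
  have h := ENNReal.ofReal_le_ofReal (norm_weighted_dyadicSum_le c hmn hM x)
  rw [ofReal_norm, ENNReal.ofReal_add (by positivity) (by positivity),
    ENNReal.ofReal_mul (by norm_num), ofReal_norm,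
    ENNReal.ofReal_sum_of_nonneg fun t _ => by positivity] at h
  refine h.trans_eq ?_
  rw [translateSum]
  congr 1
  · simp
  · refine Finset.sum_congr rfl fun t _ => ?_
    rw [ENNReal.ofReal_mul (by positivity), ofReal_norm, ENNReal.ofReal_pow (by norm_num),
      ENNReal.ofReal_inv_of_pos two_pos, ENNReal.ofReal_ofNat]

/-- For `p < 1` conditional expectation is not a contraction; averaging two translates loses the
factor `2 ^ (1 - p)`. This loss produces the growth of the means. -/
theorem lintegral_dyadicSum_rpow_le_succ {p : ℝ} (hp : 0 < p) (hp1 : p ≤ 1) (c : ℕ → ℂ)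
    (n : ℕ) :
    ∫⁻ x, ‖dyadicSum c n x‖ₑ ^ p ∂haar ≤
      2 * 2⁻¹ ^ p * ∫⁻ x, ‖dyadicSum c (n + 1) x‖ₑ ^ p ∂haar := by
  have hm : Measurable fun x => ‖dyadicSum c (n + 1) x‖ₑ ^ p :=
    (measurable_dyadicSum c (n + 1)).enorm.pow_const p
  have hm' : Measurable fun x => ‖dyadicSum c (n + 1) (flip n x)‖ₑ ^ p :=
    hm.comp (measurePreserving_flip n).measurable
  calc ∫⁻ x, ‖dyadicSum c n x‖ₑ ^ p ∂haar
      ≤ ∫⁻ x, 2⁻¹ ^ p * (‖dyadicSum c (n + 1) x‖ₑ ^ p +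
          ‖dyadicSum c (n + 1) (flip n x)‖ₑ ^ p) ∂haar := by
        refine lintegral_mono fun x => ?_
        rw [dyadicSum_eq_average, div_eq_inv_mul, enorm_mul,
          ENNReal.mul_rpow_of_nonneg _ _ hp.le, enorm_inv two_ne_zero]
        have : ‖(2 : ℂ)‖ₑ = 2 := by
          rw [← ofReal_norm]; simp
        rw [this]
        gcongr
        exact (ENNReal.rpow_le_rpow (enorm_add_le _ _) hp.le).trans
          (ENNReal.rpow_add_le_add_rpow _ _ hp.le hp1)
    _ = _ := by
        have hadd : Measurable fun x => ‖dyadicSum c (n + 1) x‖ₑ ^ p +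
            ‖dyadicSum c (n + 1) (flip n x)‖ₑ ^ p := hm.add hm'
        rw [lintegral_const_mul _ hadd, lintegral_add_left hm,
          (measurePreserving_flip n).lintegral_comp hm]
        ring

theorem lintegral_dyadicSum_rpow_le_add {p : ℝ} (hp : 0 < p) (hp1 : p ≤ 1) (c : ℕ → ℂ)
    (n j : ℕ) :
    ∫⁻ x, ‖dyadicSum c n x‖ₑ ^ p ∂haar ≤
      (2 * 2⁻¹ ^ p) ^ j * ∫⁻ x, ‖dyadicSum c (n + j) x‖ₑ ^ p ∂haar := by
  induction j with
  | zero => simp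
  | succ j ih =>
    refine ih.trans ?_
    rw [pow_succ, mul_assoc, ← add_assoc]
    gcongr
    exact lintegral_dyadicSum_rpow_le_succ hp hp1 c (n + j)

theorem measurable_maximalFn_dyadicSum (c : ℕ → ℂ) : Measurable (maximalFn (dyadicSum c)) :=
  Measurable.iSup fun n => (measurable_dyadicSum c n).enorm

theorem enorm_le_maximalFn (f : ℕ → G → ℂ) (n : ℕ) (x : G) : ‖f n x‖ₑ ≤ maximalFn f x :=
  le_iSup (fun n => ‖f n x‖ₑ) n

theorem enorm_rademacher (k : ℕ) (x : G) : ‖rademacher k x‖ₑ = 1 := by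
  rw [← ofReal_norm, norm_rademacher, ENNReal.ofReal_one]

theorem enorm_shifted_dyadicSum_le (c : ℕ → ℂ) (n : ℕ) (x : G) :
    ‖dyadicSum (fun i => c (2 ^ n + i)) n x‖ₑ ≤ 2 * maximalFn (dyadicSum c) x := by
  calc ‖dyadicSum (fun i => c (2 ^ n + i)) n x‖ₑ
      = ‖dyadicSum c (n + 1) x - dyadicSum c n x‖ₑ := by
        rw [dyadicSum_succ, add_sub_cancel_left, enorm_mul, enorm_rademacher, one_mul]
    _ ≤ ‖dyadicSum c (n + 1) x‖ₑ + ‖dyadicSum c n x‖ₑ := enorm_sub_le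
    _ ≤ _ := by
        rw [two_mul]
        gcongr <;> apply enorm_le_maximalFn

theorem fejer_two_pow_add_two_pow (c : ℕ → ℂ) {n s : ℕ} (h : s ≤ n) (x : G) :
    fejer (2 ^ n + 2 ^ s) (dyadicSum c) x =
      ∑ i ∈ Finset.range (2 ^ n),
        ((((2 ^ n + 2 ^ s : ℕ) : ℂ) - i) / ((2 ^ n + 2 ^ s : ℕ) : ℂ) * c i) * walsh i x +
      rademacher n x * ((2 ^ s / ((2 ^ n + 2 ^ s : ℕ) : ℂ)) *
        ∑ i ∈ Finset.range (2 ^ s),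
          ((((2 ^ s : ℕ) : ℂ) - i) / ((2 ^ s : ℕ) : ℂ) * c (2 ^ n + i)) * walsh i x) := by
  rw [fejer_dyadicSum c (by positivity), Finset.sum_range_add, Finset.mul_sum, Finset.mul_sum]
  congr 1
  refine Finset.sum_congr rfl fun i hi => ?_
  rw [walsh_two_pow_add ((Finset.mem_range.1 hi).trans_le (Nat.pow_le_pow_right two_pos h))]
  have h1 : ((2 ^ n + 2 ^ s : ℕ) : ℂ) ≠ 0 := by
    have : 2 ^ n + 2 ^ s ≠ 0 := by positivity
    exact_mod_cast this
  push_cast at h1 ⊢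
  field_simp
  ring

theorem maximalFn_fejer_le (c : ℕ → ℂ) {n s : ℕ} (h : s ≤ n) (x : G) :
    maximalFn (toMartingale (fejer (2 ^ n + 2 ^ s) (dyadicSum c))) x ≤
      translateSum n (maximalFn (dyadicSum c)) x + 2⁻¹ ^ (n - s) *
        translateSum s (fun y => ‖dyadicSum (fun i => c (2 ^ n + i)) s y‖ₑ) x := by
  have hsn : 2 ^ s ≤ 2 ^ n := Nat.pow_le_pow_right two_pos h
  have hfirst : ∀ m ≤ n, ‖∑ i ∈ Finset.range (2 ^ m),
      ((((2 ^ n + 2 ^ s : ℕ) : ℂ) - i) / ((2 ^ n + 2 ^ s : ℕ) : ℂ) * c i) * walsh i x‖ₑ ≤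
      translateSum n (maximalFn (dyadicSum c)) x := fun m hm =>
    (enorm_weighted_dyadicSum_le c hm (Nat.le_add_right _ _) x).trans
      (translateSum_mono n (fun y => enorm_le_maximalFn _ m y) x)
  have hrw : fejer (2 ^ n + 2 ^ s) (dyadicSum c) = fun y =>
      ∑ i ∈ Finset.range (2 ^ n + 2 ^ s), ((((2 ^ n + 2 ^ s : ℕ) : ℂ) - i) /
        ((2 ^ n + 2 ^ s : ℕ) : ℂ) * c i) * walsh i y :=
    funext fun y => fejer_dyadicSum c (by positivity) y
  refine iSup_le fun m => ?_
  -- For `m ≤ n` the truncation cuts inside the head; for `m > n` it keeps every index, since `2 ^ n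
  -- + 2 ^ s ≤ 2 ^ (n + 1)`.
  rcases le_or_gt m n with hm | hm
  · have hmn : 2 ^ m ≤ 2 ^ n := Nat.pow_le_pow_right two_pos hm
    have hs0 := Nat.two_pow_pos s
    rw [hrw, toMartingale_walsh_sum]
    have hfil : {i ∈ Finset.range (2 ^ n + 2 ^ s) | i < 2 ^ m} = Finset.range (2 ^ m) := by
      ext i
      simp only [Finset.mem_filter, Finset.mem_range]
      omega
    rw [hfil]
    exact (hfirst m hm).trans le_self_add
  · have hmn : 2 ^ (n + 1) ≤ 2 ^ m := Nat.pow_le_pow_right two_pos hm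
    have hfil : {i ∈ Finset.range (2 ^ n + 2 ^ s) | i < 2 ^ m} =
        Finset.range (2 ^ n + 2 ^ s) := by
      ext i
      simp only [Finset.mem_filter, Finset.mem_range]
      rw [pow_succ] at hmn
      omega
    have htop : toMartingale (fejer (2 ^ n + 2 ^ s) (dyadicSum c)) m x =
        fejer (2 ^ n + 2 ^ s) (dyadicSum c) x := by
      rw [hrw, toMartingale_walsh_sum, hfil]
    rw [htop, fejer_two_pow_add_two_pow c h]
    refine (enorm_add_le _ _).trans (add_le_add (hfirst n le_rfl) ?_)
    rw [enorm_mul, enorm_rademacher, one_mul, enorm_mul]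
    refine mul_le_mul' ?_ (enorm_weighted_dyadicSum_le _ le_rfl le_rfl x)
    have hr : ‖(2 : ℂ) ^ s / ((2 ^ n + 2 ^ s : ℕ) : ℂ)‖ ≤ 2⁻¹ ^ (n - s) := by
      rw [norm_div, norm_pow, Complex.norm_natCast, Complex.norm_ofNat, inv_pow,
        div_le_iff₀ (by positivity), inv_mul_eq_div, le_div_iff₀ (by positivity), ← pow_add,
        Nat.add_sub_cancel' h]
      push_cast
      linarith [show (0 : ℝ) < 2 ^ s by positivity]
    have := ENNReal.ofReal_le_ofReal hr
    rwa [ofReal_norm, ENNReal.ofReal_pow (by norm_num), ENNReal.ofReal_inv_of_pos two_pos,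
      ENNReal.ofReal_ofNat] at this

theorem lintegral_maximalFn_fejer_le {p : ℝ} (hp : 0 < p) (hp2 : p < 1 / 2) (c : ℕ → ℂ)
    {n s : ℕ} (h : s ≤ n) :
    ∫⁻ x, maximalFn (toMartingale (fejer (2 ^ n + 2 ^ s) (dyadicSum c))) x ^ p ∂haar ≤
      translateConst p * (1 + 2 ^ p) * 2 ^ ((1 - 2 * p) * ((n - s : ℕ) : ℝ)) *
        ∫⁻ x, maximalFn (dyadicSum c) x ^ p ∂haar := by
  have hp1 : p ≤ 1 := by linarith
  obtain ⟨j, rfl⟩ := Nat.exists_eq_add_of_le h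
  rw [Nat.add_sub_cancel_left]
  set d : ℕ → ℂ := fun i => c (2 ^ (s + j) + i) with hd
  set I := ∫⁻ x, maximalFn (dyadicSum c) x ^ p ∂haar with hI
  have hmax := measurable_maximalFn_dyadicSum c
  have hdm : Measurable fun y => ‖dyadicSum d s y‖ₑ := (measurable_dyadicSum d s).enorm
  have htr : ∀ (k : ℕ) {φ : G → ℝ≥0∞}, Measurable φ → Measurable (translateSum k φ) := by
    intro k φ hφ
    exact (hφ.const_mul _).add (Finset.measurable_fun_sum _ fun t _ =>
      (hφ.comp (measurePreserving_flip t).measurable).const_mul _)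
  have hd_int : ∫⁻ x, ‖dyadicSum d s x‖ₑ ^ p ∂haar ≤ (2 * 2⁻¹ ^ p) ^ j * (2 ^ p * I) := by
    refine (lintegral_dyadicSum_rpow_le_add hp hp1 d s j).trans ?_
    gcongr
    rw [hI, ← lintegral_const_mul _ (hmax.pow_const p)]
    refine lintegral_mono fun x => ?_
    rw [← ENNReal.mul_rpow_of_nonneg _ _ hp.le]
    exact ENNReal.rpow_le_rpow (enorm_shifted_dyadicSum_le c (s + j) x) hp.le
  have hconst : ((2⁻¹ : ℝ≥0∞) ^ p) ^ j * (2 * 2⁻¹ ^ p) ^ j = 2 ^ ((1 - 2 * p) * (j : ℝ)) := by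
    rw [← mul_pow, ENNReal.inv_rpow, ← ENNReal.rpow_neg, ENNReal.rpow_mul, ENNReal.rpow_natCast]
    congr 1
    nth_rw 2 [← ENNReal.rpow_one 2]
    rw [← ENNReal.rpow_add _ _ (by simp) (by simp), ← ENNReal.rpow_add _ _ (by simp) (by simp)]
    congr 1
    ring
  -- Here `p < 1 / 2` enters: the bounded contribution of the head is absorbed by the growing
  -- factor.
  have hone : (1 : ℝ≥0∞) ≤ 2 ^ ((1 - 2 * p) * (j : ℝ)) :=
    ENNReal.rpow_zero.symm.le.trans (ENNReal.rpow_le_rpow_of_exponent_le one_le_two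
      (mul_nonneg (by linarith) (by positivity)))
  calc _ ≤ ∫⁻ x, (translateSum (s + j) (maximalFn (dyadicSum c)) x ^ p +
          (2⁻¹ ^ p) ^ j * translateSum s (fun y => ‖dyadicSum d s y‖ₑ) x ^ p) ∂haar := by
        refine lintegral_mono fun x => ?_
        refine (ENNReal.rpow_le_rpow (maximalFn_fejer_le c h x) hp.le).trans ?_
        refine (ENNReal.rpow_add_le_add_rpow _ _ hp.le hp1).trans_eq ?_
        rw [Nat.add_sub_cancel_left, ENNReal.mul_rpow_of_nonneg _ _ hp.le,
          ← ENNReal.rpow_natCast, ← ENNReal.rpow_natCast, ← ENNReal.rpow_mul,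
          ← ENNReal.rpow_mul, mul_comm p]
    _ = ∫⁻ x, translateSum (s + j) (maximalFn (dyadicSum c)) x ^ p ∂haar +
          (2⁻¹ ^ p) ^ j * ∫⁻ x, translateSum s (fun y => ‖dyadicSum d s y‖ₑ) x ^ p ∂haar := by
        rw [lintegral_add_left ((htr _ hmax).pow_const p),
          lintegral_const_mul _ ((htr _ hdm).pow_const p)]
    _ ≤ translateConst p * I +
          (2⁻¹ ^ p) ^ j * (translateConst p * ((2 * 2⁻¹ ^ p) ^ j * (2 ^ p * I))) := by
        gcongr
        · exact lintegral_translateSum_rpow_le hp hp1 _ hmax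
        · exact (lintegral_translateSum_rpow_le hp hp1 _ hdm).trans (by gcongr)
    _ = translateConst p * I * 1 + translateConst p * I * 2 ^ p *
          ((2⁻¹ ^ p) ^ j * (2 * 2⁻¹ ^ p) ^ j) := by ring
    _ ≤ translateConst p * I * 2 ^ ((1 - 2 * p) * (j : ℝ)) + translateConst p * I * 2 ^ p *
          2 ^ ((1 - 2 * p) * (j : ℝ)) := by
        rw [hconst]
        gcongr
    _ = _ := by ring

theorem hpNorm_fejer_le {p : ℝ} (hp : 0 < p) (hp2 : p < 1 / 2) (c : ℕ → ℂ) {n s : ℕ}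
    (h : s ≤ n) :
    hpNorm p (toMartingale (fejer (2 ^ n + 2 ^ s) (dyadicSum c))) ≤
      (translateConst p * (1 + 2 ^ p)) ^ (1 / p) *
        2 ^ ((1 / p - 2) * ((n - s : ℕ) : ℝ)) * hpNorm p (dyadicSum c) := by
  have hp' : 0 ≤ 1 / p := by positivity
  refine (ENNReal.rpow_le_rpow (lintegral_maximalFn_fejer_le hp hp2 c h) hp').trans_eq ?_
  rw [ENNReal.mul_rpow_of_nonneg _ _ hp', ENNReal.mul_rpow_of_nonneg _ _ hp', ← ENNReal.rpow_mul]
  congr 3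
  field_simp

/-- The upper bounds for the Fejér means with the indices `2 ^ n + 2 ^ s n`. -/
theorem exists_hpNorm_fejer_le {p : ℝ} (hp : 0 < p) (hp2 : p < 1 / 2) :
    ∃ c : ℝ, 0 < c ∧ ∀ f : ℕ → G → ℂ, MemHp p f → ∀ n s : ℕ, s ≤ n → ∀ r : ℝ,
      (1 / p - 2) * ((n - s : ℕ) : ℝ) ≤ (1 / p - 2) + r →
      hpNorm p (toMartingale (fejer (2 ^ n + 2 ^ s) f)) ≤
        ENNReal.ofReal (c * (2 : ℝ) ^ r) * hpNorm p f := by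
  -- The extra factor `2 ^ (1 / p - 2)` pays for an exponent exceeding `r` by up to one unit of `n -
  -- s`, as happens when `n / 2` is rounded.
  set K : ℝ≥0∞ := (translateConst p * (1 + 2 ^ p)) ^ (1 / p) * 2 ^ (1 / p - 2) with hK
  have hKtop : K ≠ ∞ := by
    refine ENNReal.mul_ne_top (ENNReal.rpow_ne_top_of_nonneg (by positivity)
      (ENNReal.mul_ne_top (translateConst_ne_top hp) ?_)) (by simp)
    exact ENNReal.add_ne_top.2 ⟨ENNReal.one_ne_top, by simp⟩
  refine ⟨K.toReal + 1, by positivity, fun f hf n s hs r hr => ?_⟩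
  obtain ⟨c, rfl⟩ := exists_coeff_of_martingale hf.1
  refine (hpNorm_fejer_le hp hp2 c hs).trans ?_
  gcongr
  rw [ENNReal.ofReal_mul (by positivity), ← ENNReal.ofReal_rpow_of_pos two_pos,
    ENNReal.ofReal_ofNat]
  calc _ ≤ (translateConst p * (1 + 2 ^ p)) ^ (1 / p) * 2 ^ ((1 / p - 2) + r) := by
        gcongr
        norm_num
    _ = K * 2 ^ r := by
        rw [ENNReal.rpow_add _ _ (by simp) (by simp), ← mul_assoc]
    _ ≤ _ := by
        gcongr
        rw [← ENNReal.ofReal_toReal hKtop]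
        exact ENNReal.ofReal_le_ofReal (by simp)

/-! ### Sharpness -/

theorem walsh_eq_one_of_mem {i n : ℕ} (h : i < 2 ^ n) {x : G} (hx : x ∈ interval n 0) :
    walsh i x = 1 := by
  rw [walsh_congr h hx]
  simp [walsh, rademacher]

/-- The Walsh-Dirichlet kernel of order `2 ^ n` is supported on `I_n(0)`. -/
theorem dyadicSum_one (n : ℕ) (x : G) [Decidable (x ∈ interval n 0)] :
    dyadicSum (fun _ => 1) n x = if x ∈ interval n 0 then 2 ^ n else 0 := by
  split_ifs with h
  · rw [dyadicSum, Finset.sum_congr rfl fun i hi => by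
      rw [walsh_eq_one_of_mem (Finset.mem_range.1 hi) h]]
    simp
  · have hprod : ∀ m, dyadicSum (fun _ => 1) m x =
        ∏ k ∈ Finset.range m, (1 + rademacher k x) := by
      intro m
      induction m with
      | zero => simp [dyadicSum, walsh_zero]
      | succ m ih => rw [dyadicSum_succ, ih, Finset.prod_range_succ]; ring
    obtain ⟨k, hk, hxk⟩ : ∃ k < n, x k ≠ 0 := by
      simpa [interval] using h
    rw [hprod]
    refine Finset.prod_eq_zero (Finset.mem_range.2 hk) ?_
    have h1 : x k = 1 := by revert hxk; generalize x k = a; revert a; decide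
    simp [rademacher, h1]

/-- Walsh coefficients that are constant on the dyadic blocks `[2 ^ a, 2 ^ (a + 1))`. -/
def blockCoeff (b : ℕ → ℂ) (i : ℕ) : ℂ := if i = 0 then 0 else b (Nat.log 2 i)

theorem blockCoeff_two_pow_add (b : ℕ → ℂ) {n i : ℕ} (h : i < 2 ^ n) :
    blockCoeff b (2 ^ n + i) = b n := by
  have h0 : 2 ^ n + i ≠ 0 := by have := Nat.two_pow_pos n; omega
  have h1 : Nat.log 2 (2 ^ n + i) = n :=
    Nat.log_eq_of_pow_le_of_lt_pow (Nat.le_add_right _ _) (by rw [pow_succ]; omega)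
  rw [blockCoeff, if_neg h0, h1]

theorem dyadicSum_blockCoeff (b : ℕ → ℂ) (n : ℕ) (x : G) :
    dyadicSum (blockCoeff b) n x =
      ∑ a ∈ Finset.range n, rademacher a x * (b a * dyadicSum (fun _ => 1) a x) := by
  induction n with
  | zero => simp [dyadicSum, blockCoeff]
  | succ n ih =>
    rw [dyadicSum_succ, ih, Finset.sum_range_succ]
    congr 2
    rw [dyadicSum, dyadicSum, Finset.mul_sum]
    refine Finset.sum_congr rfl fun i hi => ?_
    rw [blockCoeff_two_pow_add b (Finset.mem_range.1 hi), one_mul]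

/-- Block `a` has modulus `‖b a‖ * 2 ^ a` on `I_a(0)`, of measure `2 ^ (-a)`, and vanishes
elsewhere; subadditivity of the `p`-th power adds the blocks up. -/
theorem lintegral_maximalFn_blockCoeff_le {p : ℝ} (hp : 0 < p) (hp1 : p ≤ 1) (b : ℕ → ℂ) :
    ∫⁻ x, maximalFn (dyadicSum (blockCoeff b)) x ^ p ∂haar ≤
      ∑' a, (‖b a‖ₑ * 2 ^ a) ^ p * (2 ^ a)⁻¹ := by
  classical
  have hpt : ∀ x, maximalFn (dyadicSum (blockCoeff b)) x ^ p ≤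
      ∑' a, (interval a 0).indicator (fun _ => (‖b a‖ₑ * 2 ^ a) ^ p) x := by
    intro x
    rw [← ENNReal.le_rpow_inv_iff hp]
    refine iSup_le fun n => ?_
    rw [ENNReal.le_rpow_inv_iff hp, dyadicSum_blockCoeff]
    refine (ENNReal.rpow_le_rpow (enorm_sum_le _ _) hp.le).trans ?_
    refine (sum_rpow_le hp hp1 _ _).trans ?_
    refine (Finset.sum_le_sum fun a _ => ?_).trans (ENNReal.sum_le_tsum (Finset.range n))
    rw [enorm_mul, enorm_rademacher, one_mul, enorm_mul, dyadicSum_one]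
    split_ifs with h
    · have h2 : ‖(2 : ℂ) ^ a‖ₑ = 2 ^ a := by
        rw [enorm_pow, ← ofReal_norm]; simp
      rw [Set.indicator_of_mem h, h2]
    · simp [hp]
  refine (lintegral_mono hpt).trans_eq ?_
  rw [lintegral_tsum fun a =>
    (measurable_const.indicator (measurableSet_interval a 0)).aemeasurable]
  refine tsum_congr fun a => ?_
  rw [lintegral_indicator_const (measurableSet_interval a 0), haar_interval]

/-- The weights for which the blocks are multiples of `p`-atoms with the factors `l a`. -/
def atomicWeight (p : ℝ) (l : ℕ → ℝ) (a : ℕ) : ℂ := ((l a * 2 ^ ((1 / p - 1) * (a : ℝ)) : ℝ) : ℂ)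

theorem memHp_atomicWeight {p : ℝ} (hp : 0 < p) (hp1 : p ≤ 1) {l : ℕ → ℝ}
    (hl : ∑' a, ‖l a‖ₑ ^ p ≠ ∞) : MemHp p (dyadicSum (blockCoeff (atomicWeight p l))) := by
  refine ⟨martingale_dyadicSum _, ENNReal.rpow_lt_top_of_nonneg (by positivity) ?_⟩
  refine ne_top_of_le_ne_top hl ((lintegral_maximalFn_blockCoeff_le hp hp1 _).trans_eq ?_)
  refine tsum_congr fun a => ?_
  have h1 : ‖atomicWeight p l a‖ₑ = ‖l a‖ₑ * 2 ^ ((1 / p - 1) * (a : ℝ)) := by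
    rw [atomicWeight, ← ofReal_norm, Complex.norm_real, norm_mul,
      ENNReal.ofReal_mul (norm_nonneg _), ofReal_norm,
      Real.norm_of_nonneg (by positivity), ← ENNReal.ofReal_rpow_of_pos two_pos,
      ENNReal.ofReal_ofNat]
  have h2 : (2 : ℝ≥0∞) ^ ((1 / p - 1) * (a : ℝ)) * 2 ^ a = 2 ^ ((a : ℝ) / p) := by
    rw [← ENNReal.rpow_natCast, ← ENNReal.rpow_add _ _ (by simp) (by simp)]
    congr 1
    ring
  rw [h1, mul_assoc, h2, ENNReal.mul_rpow_of_nonneg _ _ hp.le, ← ENNReal.rpow_mul,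
    div_mul_cancel₀ _ hp.ne', ENNReal.rpow_natCast, mul_assoc,
    ENNReal.mul_inv_cancel (by simp) (by simp), mul_one]

/-- Since `g x - g (flip n x) = 2 r_n(x) β`, one of the two values has modulus at least `‖β‖`. Hence
the level set and its flip cover `I_s(0)`, and it has at least half that measure, whatever `a` is.
-/
theorem le_weakLpNorm_of_flip {p : ℝ} (hp : 0 < p) {n s : ℕ} (hs : s ≤ n) {g a : G → ℂ} {β : ℂ}
    (hg : ∀ x ∈ interval s 0, g x = a x + rademacher n x * β) (ha : ∀ x, a (flip n x) = a x)
    {t : ℝ≥0} (ht : 0 < t) (htβ : t < ‖β‖) :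
    (t : ℝ≥0∞) * ((2 ^ (s + 1))⁻¹) ^ (1 / p) ≤ weakLpNorm p g := by
  set E : Set G := {x | (t : ℝ≥0∞) < ‖g x‖ₑ} with hE
  have hsub : interval s 0 ⊆ E ∪ flip n ⁻¹' E := by
    intro x hx
    by_contra hnot
    simp only [hE, Set.mem_union, Set.mem_preimage, Set.mem_ofPred_eq, not_or, not_lt] at hnot
    have hx' : flip n x ∈ interval s 0 :=
      (interval_congr (flip_mem_interval hs x) 0).2 hx
    have h1 : ‖g x‖ ≤ t := by
      have := hnot.1
      rw [← ofReal_norm, ENNReal.ofReal_le_coe] at this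
      exact this
    have h2 : ‖g (flip n x)‖ ≤ t := by
      have := hnot.2
      rw [← ofReal_norm, ENNReal.ofReal_le_coe] at this
      exact this
    have h3 : g x - g (flip n x) = 2 * (rademacher n x * β) := by
      rw [hg x hx, hg _ hx', ha, rademacher_flip, if_pos rfl]
      ring
    have h4 := norm_sub_le (g x) (g (flip n x))
    rw [h3, norm_mul, norm_mul, norm_rademacher, Complex.norm_ofNat] at h4
    linarith
  have hmeas : (2 ^ (s + 1) : ℝ≥0∞)⁻¹ ≤ haar E := by
    have h1 : haar (flip n ⁻¹' E) = haar E :=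
      (measurePreserving_flip n).measure_preimage_emb (flipEquiv n).measurableEmbedding E
    have h2 := (measure_mono hsub).trans (measure_union_le (μ := haar) E (flip n ⁻¹' E))
    rw [haar_interval, h1, ← two_mul] at h2
    rw [pow_succ, ENNReal.mul_inv (by simp) (by simp), ← div_eq_mul_inv]
    exact ENNReal.div_le_of_le_mul' h2
  calc (t : ℝ≥0∞) * ((2 ^ (s + 1))⁻¹) ^ (1 / p)
      ≤ (t : ℝ≥0∞) * haar E ^ (1 / p) := by gcongr
    _ = ((t : ℝ≥0∞) ^ p * haar E) ^ (1 / p) := by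
        rw [ENNReal.mul_rpow_of_nonneg _ _ (by positivity), ← ENNReal.rpow_mul,
          mul_one_div_cancel hp.ne', ENNReal.rpow_one]
    _ ≤ weakLpNorm p g := by
        unfold weakLpNorm
        gcongr
        exact le_iSup₂ (f := fun (t : ℝ≥0) (_ : 0 < t) =>
          (t : ℝ≥0∞) ^ p * haar {x | (t : ℝ≥0∞) < ‖g x‖ₑ}) t ht

theorem sum_range_sub_index (m : ℕ) :
    ∑ i ∈ Finset.range m, ((m : ℂ) - i) = (m : ℂ) * (m + 1) / 2 := by
  induction m with
  | zero => simp
  | succ m ih =>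
    rw [Finset.sum_range_succ]
    have : ∀ i : ℕ, (((m + 1 : ℕ) : ℂ) - i) = ((m : ℂ) - i) + 1 := fun i => by push_cast; ring
    simp_rw [this]
    rw [Finset.sum_add_distrib, ih]
    simp
    ring

/-- The weak norm of a Fejér mean of a block series is at least the contribution of the
top block. -/
theorem le_weakLpNorm_fejer {p : ℝ} (hp : 0 < p) (b : ℕ → ℂ) {n s : ℕ} (hs : s ≤ n) {φ : ℝ}
    (hφ : 0 < φ) (hb : b n ≠ 0) :
    ENNReal.ofReal (‖b n‖ * 4 ^ s / 2 ^ (n + 3) / φ) * ((2 ^ (s + 1))⁻¹) ^ (1 / p) ≤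
      weakLpNorm p
        (fun x => fejer (2 ^ n + 2 ^ s) (dyadicSum (blockCoeff b)) x / (φ : ℂ)) := by
  have hb' : 0 < ‖b n‖ := norm_pos_iff.2 hb
  set N : ℂ := ((2 ^ n + 2 ^ s : ℕ) : ℂ) with hN
  -- On `I_s(0)` the tail's Walsh functions `w_i`, `i < 2 ^ s`, equal `1`, so the tail reduces to
  -- the sum of its weights.
  set β : ℂ := 2 ^ s / N * ((2 ^ s + 1) / 2 * b n) / φ with hβ
  refine le_weakLpNorm_of_flip hp hs (β := β)
    (a := fun x => dyadicSum (fun i => (N - i) / N * blockCoeff b i) n x / φ)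
    ?_ ?_ (Real.toNNReal_pos.2 (by positivity)) ?_
  · intro x hx
    have h1 : ∑ i ∈ Finset.range (2 ^ s),
        ((((2 ^ s : ℕ) : ℂ) - i) / ((2 ^ s : ℕ) : ℂ) * blockCoeff b (2 ^ n + i)) * walsh i x =
        (2 ^ s + 1) / 2 * b n := by
      have h2 : ∀ i ∈ Finset.range (2 ^ s),
          ((((2 ^ s : ℕ) : ℂ) - i) / ((2 ^ s : ℕ) : ℂ) * blockCoeff b (2 ^ n + i)) * walsh i x =
          (((2 ^ s : ℕ) : ℂ) - i) * (b n / 2 ^ s) := by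
        intro i hi
        have hi := Finset.mem_range.1 hi
        rw [walsh_eq_one_of_mem hi hx,
          blockCoeff_two_pow_add b (hi.trans_le (Nat.pow_le_pow_right two_pos hs))]
        push_cast
        ring
      rw [Finset.sum_congr rfl h2, ← Finset.sum_mul, sum_range_sub_index]
      push_cast
      field_simp
    simp only [fejer_two_pow_add_two_pow _ hs, h1, hβ, dyadicSum]
    ring
  · intro x
    simp only [dyadicSum_flip _ le_rfl]
  · rw [Real.coe_toNNReal _ (by positivity)]
    have h1 : ‖β‖ = ‖b n‖ * (2 ^ s * (2 ^ s + 1)) / (2 ^ n + 2 ^ s) / 2 / φ := by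
      have h2 : ‖((2 : ℂ) ^ s + 1)‖ = 2 ^ s + 1 := by
        have := Complex.norm_natCast (2 ^ s + 1)
        push_cast at this
        exact this
      have h3 : ‖(φ : ℂ)‖ = φ := by rw [Complex.norm_real, Real.norm_of_nonneg hφ.le]
      rw [hβ, hN, norm_div, norm_mul, norm_mul, norm_div, norm_div, Complex.norm_natCast, h2, h3]
      push_cast
      simp only [norm_pow, Complex.norm_ofNat]
      ring
    rw [h1, div_div (_ / _) 2 φ, div_div, div_div]
    rw [mul_div_assoc, mul_div_assoc]
    refine mul_lt_mul_of_pos_left ?_ hb'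
    have h4 : (4 : ℝ) ^ s = 2 ^ s * 2 ^ s := by rw [← mul_pow]; norm_num
    have h5 : (2 : ℝ) ^ s ≤ 2 ^ n := pow_le_pow_right₀ (by norm_num) hs
    have h6 : (0 : ℝ) < 2 ^ s := by positivity
    have h7 : (0 : ℝ) < 2 ^ n := by positivity
    rw [div_lt_div_iff₀ (by positivity) (by positivity), h4, pow_add]
    have h8 : (2 ^ n + 2 ^ s) * (2 * φ) ≤ 2 ^ n * 2 ^ 3 * φ := by nlinarith
    have h9 : (0 : ℝ) < 2 ^ n * 2 ^ 3 * φ := by positivity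
    calc (2 : ℝ) ^ s * 2 ^ s * ((2 ^ n + 2 ^ s) * (2 * φ))
        ≤ 2 ^ s * 2 ^ s * (2 ^ n * 2 ^ 3 * φ) := by gcongr
      _ < 2 ^ s * (2 ^ s + 1) * (2 ^ n * 2 ^ 3 * φ) := by gcongr; linarith

theorem tsum_extend_geometric_rpow_ne_top {p : ℝ} (hp : 0 < p) {α : ℕ → ℕ}
    (hα : Function.Injective α) :
    ∑' a, ‖Function.extend α (fun j => (2⁻¹ : ℝ) ^ j) 0 a‖ₑ ^ p ≠ ∞ := by
  rw [← hα.tsum_eq (f := fun a => ‖Function.extend α (fun j => (2⁻¹ : ℝ) ^ j) 0 a‖ₑ ^ p)]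
  · have h : ∀ j, ‖Function.extend α (fun j => (2⁻¹ : ℝ) ^ j) 0 (α j)‖ₑ ^ p =
        (2⁻¹ ^ p) ^ j := by
      intro j
      rw [hα.extend_apply, enorm_pow, ← ENNReal.rpow_natCast, ← ENNReal.rpow_natCast,
        ← ENNReal.rpow_mul, ← ENNReal.rpow_mul, mul_comm p]
      congr 1
      rw [← ofReal_norm, norm_inv, Real.norm_ofNat, ENNReal.ofReal_inv_of_pos two_pos,
        ENNReal.ofReal_ofNat]
    simp_rw [h]
    rw [ENNReal.tsum_geometric, ENNReal.inv_ne_top, ne_eq, tsub_eq_zero_iff_le, not_le]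
    exact ENNReal.rpow_lt_one (by simp) hp
  · intro a ha
    by_contra hr
    refine ha ?_
    simp only [Function.extend_apply' _ _ _ (fun ⟨j, hj⟩ => hr ⟨j, hj⟩)]
    simp [hp]

/-- Sharpness of the upper bounds for the Fejér means with the indices `2 ^ n + 2 ^ s n`. -/
theorem sharpRate_two_pow_add_two_pow {p : ℝ} (hp : 0 < p) (hp1 : p ≤ 1) {s : ℕ → ℕ}
    (hs : ∀ n, s n ≤ n) {R : ℕ → ℝ}
    (hR : ∀ n, R n ≤ (2 : ℝ) ^ ((1 / p - 2) * ((n : ℝ) - s n))) :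
    SharpRate p (fun n => 2 ^ n + 2 ^ s n) R := by
  intro Φ _ hΦ hlim
  -- The threshold `4 ^ j` beats the atomic factor `2⁻¹ ^ j` used below and leaves `2 ^ j`, which is
  -- unbounded.
  have hfreq : ∀ j : ℕ, ∃ᶠ k in atTop, (4 : ℝ) ^ j < R k / Φ (2 ^ k + 2 ^ s k) := by
    intro j
    have h1 : ENNReal.ofReal ((4 : ℝ) ^ j) <
        limsup (fun k : ℕ => ENNReal.ofReal (R k / Φ (2 ^ k + 2 ^ s k))) atTop := by
      rw [hlim]; exact ENNReal.ofReal_lt_top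
    refine (frequently_lt_of_lt_limsup (by isBoundedDefault) h1).mono fun k hk => ?_
    exact lt_of_not_ge fun h => hk.not_ge (ENNReal.ofReal_le_ofReal h)
  obtain ⟨α, hα, hαR⟩ := extraction_forall_of_frequently hfreq
  set l : ℕ → ℝ := Function.extend α (fun j => (2⁻¹ : ℝ) ^ j) 0 with hl
  refine ⟨dyadicSum (blockCoeff (atomicWeight p l)),
    memHp_atomicWeight hp hp1 (tsum_extend_geometric_rpow_ne_top hp hα.injective), ?_⟩
  -- Collects the losses independent of `j`: `2 ^ (-3)` from the size of `β` and `2 ^ (-1 / p)` from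
  -- halving the measure of `I_s(0)`.
  set q : ℝ := 2 ^ (-3 - 1 / p) with hq
  have hq0 : 0 < q := by positivity
  have hlow : ∀ j, ENNReal.ofReal (2 ^ j * q) ≤ ⨆ k : ℕ, weakLpNorm p (fun x =>
      fejer (2 ^ k + 2 ^ s k) (dyadicSum (blockCoeff (atomicWeight p l))) x /
        (Φ (2 ^ k + 2 ^ s k) : ℂ)) := by
    intro j
    refine le_iSup_of_le (α j) ?_
    set n := α j with hn
    set φ := Φ (2 ^ n + 2 ^ s n) with hφ
    have hφ0 : 0 < φ := hΦ _
    have hln : l n = 2⁻¹ ^ j := by rw [hl, hn, hα.injective.extend_apply]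
    have hw : atomicWeight p l n = ((2⁻¹ ^ j * 2 ^ ((1 / p - 1) * (n : ℝ)) : ℝ) : ℂ) := by
      rw [atomicWeight, hln]
    have hw0 : atomicWeight p l n ≠ 0 := by
      rw [hw, Complex.ofReal_ne_zero]; positivity
    refine le_trans ?_ (le_weakLpNorm_fejer hp (atomicWeight p l) (hs n) hφ0 hw0)
    have hpow : ((2 ^ (s n + 1) : ℝ≥0∞)⁻¹) ^ (1 / p) =
        ENNReal.ofReal (2 ^ (-((s n : ℝ) + 1) / p)) := by
      rw [← ENNReal.ofReal_rpow_of_pos two_pos, ENNReal.ofReal_ofNat, ← ENNReal.rpow_natCast,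
        ← ENNReal.rpow_neg, ← ENNReal.rpow_mul]
      congr 1
      push_cast
      ring
    rw [hpow, ← ENNReal.ofReal_mul (by positivity)]
    refine ENNReal.ofReal_le_ofReal ?_
    have hnorm : ‖atomicWeight p l n‖ = 2⁻¹ ^ j * 2 ^ ((1 / p - 1) * (n : ℝ)) := by
      rw [hw, Complex.norm_real, Real.norm_of_nonneg (by positivity)]
    have hexp : (2 : ℝ) ^ ((1 / p - 1) * (n : ℝ)) * 4 ^ s n / 2 ^ (n + 3) *
        2 ^ (-((s n : ℝ) + 1) / p) = 2 ^ ((1 / p - 2) * ((n : ℝ) - s n)) * q := by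
      have h4 : (4 : ℝ) ^ s n = 2 ^ (2 * (s n : ℝ)) := by
        rw [Real.rpow_mul (by norm_num), Real.rpow_natCast]; norm_num
      rw [h4, hq, ← Real.rpow_natCast 2 (n + 3), ← Real.rpow_add two_pos,
        ← Real.rpow_sub two_pos, ← Real.rpow_add two_pos, ← Real.rpow_add two_pos]
      congr 1
      push_cast
      ring
    have hkey : (4 : ℝ) ^ j * φ ≤ 2 ^ ((1 / p - 2) * ((n : ℝ) - s n)) :=
      ((lt_div_iff₀ hφ0).1 (hαR j)).le.trans (hR n)
    calc (2 : ℝ) ^ j * q = 2⁻¹ ^ j * (4 ^ j * φ) * q / φ := by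
          have : (4 : ℝ) ^ j = 2 ^ j * 2 ^ j := by rw [← mul_pow]; norm_num
          rw [this, inv_pow]
          field_simp
      _ ≤ 2⁻¹ ^ j * 2 ^ ((1 / p - 2) * ((n : ℝ) - s n)) * q / φ := by gcongr
      _ = 2⁻¹ ^ j * (2 ^ ((1 / p - 2) * ((n : ℝ) - s n)) * q) / φ := by ring
      _ = _ := by
          rw [← hexp, hnorm]
          ring
  refine ENNReal.eq_top_of_forall_nnreal_le fun r => ?_
  obtain ⟨j, hj⟩ := pow_unbounded_of_one_lt ((r : ℝ) / q) one_lt_two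
  refine le_trans ?_ (hlow j)
  rw [← ENNReal.ofReal_coe_nnreal]
  exact ENNReal.ofReal_le_ofReal ((div_lt_iff₀ hq0).1 hj).le

end WalshFejer

end

open WalshFejer
theorem corollary4 (p : ℝ) (hp0 : 0 < p) (hp : p < 1 / 2) :
    (∃ c : ℝ, 0 < c ∧ ∀ f : ℕ → G → ℂ, MemHp p f → ∀ n : ℕ,
      hpNorm p (toMartingale (fejer (2 ^ n + 1) f)) ≤
          ENNReal.ofReal (c * (2 : ℝ) ^ ((1 / p - 2) * (n : ℝ))) * hpNorm p f ∧
      hpNorm p (toMartingale (fejer (2 ^ n + 2 ^ (n / 2)) f)) ≤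
          ENNReal.ofReal (c * (2 : ℝ) ^ ((1 / p - 2) * (n : ℝ) / 2)) * hpNorm p f) ∧
    SharpRate p (fun n => 2 ^ n + 1) (fun n => (2 : ℝ) ^ ((1 / p - 2) * (n : ℝ))) ∧
    SharpRate p (fun n => 2 ^ n + 2 ^ (n / 2))
      (fun n => (2 : ℝ) ^ ((1 / p - 2) * (n : ℝ) / 2)) := by
  have hp1 : p ≤ 1 := by linarith
  have hexp : 0 ≤ 1 / p - 2 := by
    rw [sub_nonneg, le_div_iff₀ hp0]
    linarith
  refine ⟨?_, ?_, ?_⟩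
  · obtain ⟨c, hc, h⟩ := exists_hpNorm_fejer_le hp0 hp
    refine ⟨c, hc, fun f hf n => ⟨?_, ?_⟩⟩
    · refine h f hf n 0 (Nat.zero_le n) _ ?_
      rw [Nat.sub_zero]
      linarith
    · refine h f hf n (n / 2) (Nat.div_le_self n 2) _ ?_
      -- For odd `n` the difference `n - n / 2` exceeds half of `n` by `1 / 2`; the slack in the
      -- exponent covers this.
      have h1 : 2 * (n - n / 2) ≤ n + 1 := by omega
      have h2 : 2 * ((n - n / 2 : ℕ) : ℝ) ≤ n + 1 := by exact_mod_cast h1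
      nlinarith
  · refine sharpRate_two_pow_add_two_pow hp0 hp1 (s := fun _ => 0) (fun n => Nat.zero_le n)
      fun n => ?_
    simp
  · refine sharpRate_two_pow_add_two_pow hp0 hp1 (fun n => Nat.div_le_self n 2) fun n => ?_
    refine Real.rpow_le_rpow_of_exponent_le one_le_two ?_
    -- For sharpness the rounding helps: `n - n / 2` is at least half of `n`.
    have h1 : ((n / 2 : ℕ) : ℝ) ≤ (n : ℝ) / 2 := Nat.cast_div_le
    nlinarith
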